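/- Let $G$ be a finite metacyclic group, that is, a finite group with a normal cyclic subgroup $K$ such that $G/K$ is cyclic. Let $Z(G)$ be the center of $G$ and let $H_n(G)=H_n(G,\mathbb{Z})$ denote integral group homology. Then Ganea's homomorphism $$H_1(G)\otimes Z(G)\longrightarrow H_2(G)$$ is surjective. Here Ganea's homomorphism is the first map of Ganea's exact sequence $$H_1(G)\otimes Z(G)\to H_2(G)\to H_2(G/Z(G))\to Z(G)\to H_1(G)\to H_1(G/Z(G))\to 0,$$ namely the composite $$H_1(G)\otimes Z(G)\cong H_1(G)\otimes H_1(Z(G))\xrightarrow{\ \times\ }H_2(G\times Z(G))\xrightarrow{\ \mu_*\ }H_2(G)$$ of the homology cross product and the map induced by the multiplication homomorphism $\mu\colon G\times Z(G)\to G$, $(g,z)\mapsto gz$. In terms of the bar complex it sends $gG'\otimes z$ to the class of the cycle $[g|z]-[z|g]$. -/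

import Mathlib

universe u

noncomputable section

open groupHomology Finsupp TensorProduct
open scoped IsMulCommutative

/-- A group is metacyclic if it has a normal cyclic subgroup with cyclic quotient. -/
def IsMetacyclic (G : Type u) [Group G] : Prop :=
  ∃ (K : Subgroup G) (_ : K.Normal), IsCyclic K ∧ IsCyclic (G ⧸ K)

/-- The integers with trivial `G`-action. They are lifted to the universe of `G`, as required by
Mathlib's group homology. -/
abbrev trivialInt (G : Type u) [Group G] : Rep.{u} (ULift.{u} ℤ) G :=
  Rep.trivial (ULift.{u} ℤ) G (ULift.{u} ℤ)

/-- The integral homology group `Hₙ(G) = Hₙ(G, ℤ)`. -/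
abbrev IntegralHomology (G : Type u) [Group G] (n : ℕ) : Type u :=
  groupHomology (trivialInt G) n

/-- The identity of `ℤ`, as a morphism from the trivial `G`-module `ℤ` to the trivial `H`-module
`ℤ` restricted along `f : G → H`. -/
def trivialIntRes {G H : Type u} [Group G] [Group H] (f : G →* H) :
    Quiver.Hom (trivialInt G) (Rep.res f (trivialInt H)) :=
  Rep.ofHom { toLinearMap := LinearMap.id, isIntertwining' := fun _ => rfl }

/-- The homomorphism `Hₙ(G) → Hₙ(H)` induced by a group homomorphism `G → H`. -/
def integralHomologyMap {G H : Type u} [Group G] [Group H] (f : G →* H) (n : ℕ) :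
    IntegralHomology G n →+ IntegralHomology H n :=
  (groupHomology.map f (trivialIntRes f) n).hom.toAddMonoidHom

/-- The natural isomorphism `H₁(G) ≅ G / G'`, sending the class of the cycle `[g]` to `g G'`. -/
def h1EquivAbelianization (G : Type u) [Group G] :
    IntegralHomology G 1 ≃+ Additive (Abelianization G) :=
  (H1AddEquivOfIsTrivial (trivialInt G)).trans
    (((TensorProduct.congr (LinearEquiv.refl ℤ _)
        (AddEquiv.ulift (α := ℤ)).toIntLinearEquiv).trans
      (TensorProduct.rid ℤ (Additive (Abelianization G)))).toAddEquiv)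

/-- For commuting `x` and `y`, the bar cycle `[x|y] - [y|x]`. -/
def commutingCycle {G : Type u} [Group G] (x y : G) (h : Commute x y) :
    cycles₂ (trivialInt G) :=
  ⟨single (x, y) 1 - single (y, x) 1, by
    change (d₂₁ (trivialInt G)).hom _ = 0
    rw [map_sub]
    change d₂₁ (trivialInt G) _ - d₂₁ (trivialInt G) _ = 0
    rw [d₂₁_single (A := trivialInt G), d₂₁_single (A := trivialInt G)]
    simp [h.eq]
    abel⟩

/-- The class in `H₂(G)` of the bar cycle `[x|y] - [y|x]`, for commuting `x` and `y`. -/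
def commutingClass {G : Type u} [Group G] (x y : G) (h : Commute x y) : IntegralHomology G 2 :=
  H2π (trivialInt G) (commutingCycle x y h)

theorem commutingClass_swap {G : Type u} [Group G] (x y : G) (h : Commute x y) :
    commutingClass y x h.symm = - commutingClass x y h := by
  rw [commutingClass, commutingClass, ← map_neg]
  congr 1
  apply Subtype.ext
  simp [commutingCycle]

theorem commutingClass_mul_left {G : Type u} [Group G] (x x' y : G) (h : Commute x y)
    (h' : Commute x' y) :
    commutingClass (x * x') y (h.mul_left h') =
      commutingClass x y h + commutingClass x' y h' := by
  rw [commutingClass, commutingClass, commutingClass, ← map_add]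
  refine ((H2π_eq_iff _ _).2 ⟨single (x, x', y) 1 - single (x, y, x') 1 + single (y, x, x') 1,
    ?_⟩).symm
  change d₃₂ (trivialInt G) _ = _
  rw [map_add, map_sub, d₃₂_single (A := trivialInt G), d₃₂_single (A := trivialInt G),
    d₃₂_single (A := trivialInt G)]
  simp [commutingCycle, h.eq, h'.eq]
  abel

theorem commutingClass_mul_right {G : Type u} [Group G] (x y y' : G) (h : Commute x y)
    (h' : Commute x y') :
    commutingClass x (y * y') (h.mul_right h') =
      commutingClass x y h + commutingClass x y' h' := by
  rw [← neg_inj, ← commutingClass_swap, neg_add, ← commutingClass_swap, ← commutingClass_swap,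
    commutingClass_mul_left]

theorem commutingClass_one_left {G : Type u} [Group G] (y : G) :
    commutingClass 1 y (Commute.one_left y) = 0 := by
  have h := commutingClass_mul_left 1 1 y (Commute.one_left y) (Commute.one_left y)
  simpa using h

theorem commutingClass_one_right {G : Type u} [Group G] (x : G) :
    commutingClass x 1 (Commute.one_right x) = 0 := by
  have h := commutingClass_mul_right x 1 1 (Commute.one_right x) (Commute.one_right x)
  simpa using h

theorem commute_inl_inr {G H : Type u} [Group G] [Group H] (g : G) (a : H) :
    Commute ((g, 1) : G × H) (1, a) := by
  simp [Commute, SemiconjBy]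

/-- The pairing `G / G' × H / H' → H₂(G × H)`, which sends `(g G', a H')` to the class of
`[(g, 1)|(1, a)] - [(1, a)|(g, 1)]`, the shuffle product of the cycles `[g]` and `[a]`. -/
def abelianizationCross (G H : Type u) [Group G] [Group H] :
    Additive (Abelianization G) →+ Additive (Abelianization H) →+ IntegralHomology (G × H) 2 :=
  AddMonoidHom.toMultiplicativeRight.symm <| Abelianization.lift
    { toFun g := Multiplicative.ofAdd <| AddMonoidHom.toMultiplicativeRight.symm <|
        Abelianization.lift
          { toFun a := Multiplicative.ofAdd <|
              commutingClass ((g, 1) : G × H) (1, a) (commute_inl_inr g a)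
            map_one' := commutingClass_one_right _
            map_mul' a b := by
              rw [← ofAdd_add, ← commutingClass_mul_right]
              simp }
      map_one' := by
        apply Multiplicative.toAdd.injective
        ext a
        exact commutingClass_one_left _
      map_mul' g g' := by
        apply Multiplicative.toAdd.injective
        ext a
        refine Eq.trans ?_ (commutingClass_mul_left ((g, 1) : G × H) (g', 1) (1, a)
          (commute_inl_inr g a) (commute_inl_inr g' a))
        change commutingClass _ _ _ = _
        simp }

/-- The homology cross product `H₁(G) ⊗ H₁(H) → H₂(G × H)`. -/
def homologyCross (G H : Type u) [Group G] [Group H] :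
    IntegralHomology G 1 ⊗[ℤ] IntegralHomology H 1 →+ IntegralHomology (G × H) 2 :=
  TensorProduct.liftAddHom
    ((AddMonoidHom.compHom.flip (h1EquivAbelianization H).toAddMonoidHom).comp
      ((abelianizationCross G H).comp (h1EquivAbelianization G).toAddMonoidHom))
    fun n x y => by rw [map_zsmul, map_zsmul, AddMonoidHom.smul_apply]

/-- The multiplication `G × Z(G) → G`, a group homomorphism. -/
def mulCenter (G : Type u) [Group G] : G × Subgroup.center G →* G :=
  (MonoidHom.id G).noncommCoprod (Subgroup.center G).subtype
    fun g z => Subgroup.mem_center_iff.1 z.2 g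

/-- The natural isomorphism `Z(G) ≅ H₁(Z(G))`, sending `z` to the class of the cycle `[z]`. -/
def centerEquivH1 (G : Type u) [Group G] :
    Additive (Subgroup.center G) ≃+ IntegralHomology (Subgroup.center G) 1 :=
  (MulEquiv.toAdditive (Abelianization.equivOfComm (H := Subgroup.center G))).trans
    (h1EquivAbelianization (Subgroup.center G)).symm

/-- Ganea's homomorphism `H₁(G) ⊗ Z(G) → H₂(G)` for the central extension of `G / Z(G)` by `Z(G)`:
the composite of `H₁(G) ⊗ Z(G) ≅ H₁(G) ⊗ H₁(Z(G))`, of the cross product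
`H₁(G) ⊗ H₁(Z(G)) → H₂(G × Z(G))`, and of the map `H₂(G × Z(G)) → H₂(G)` induced by the
multiplication `G × Z(G) → G`. -/
def ganeaHom (G : Type u) [Group G] :
    IntegralHomology G 1 ⊗[ℤ] Additive (Subgroup.center G) →+ IntegralHomology G 2 :=
  (integralHomologyMap (mulCenter G) 2).comp
    ((homologyCross G (Subgroup.center G)).comp
      (TensorProduct.map LinearMap.id
        (centerEquivH1 G).toAddMonoidHom.toIntLinearMap).toAddMonoidHom)

end

/-!
Let `K = ⟨a⟩` be a normal cyclic subgroup of `G` and let `b` generate `G` modulo `K`. An element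
`z ∈ K` that commutes with `b` is central, and Ganea's homomorphism maps `b G' ⊗ z` to the class of
`[b|z] - [z|b]` (`ganeaHom_tmul`). These classes already generate `H₂(G)`. To see this, it suffices
that every character `φ : H₂(G) → ℚ/ℤ` killing all of them is zero
(`character_eq_zero_of_commutingClass`).

Since `ℚ/ℤ` is injective, `φ` extends from cycles to chains, and the extension is a 2-cocycle `f`
with `f b z = f z b`. In the central extension `E` of `G` by `ℚ/ℤ` defined by `f`, each lift of `b`
therefore commutes with each lift of such a `z`. This forces `E` to split
(`exists_section_of_commute`). By divisibility, `a` has a lift of the same order. The relation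
`b a b⁻¹ = a ^ r` lifts up to a central error `d`, and the commutation hypothesis says that
`d ^ k = 1` whenever `a ^ k` commutes with `b`; by an application of Bézout's identity
(`exists_pow_eq_one_and_zpow_eq`) this is exactly what is needed to absorb `d` into the lift of `a`.
The relation `b ^ n = a ^ t` is lifted by correcting the lift of `b` by a central `n`-th root. The
lifts then generate a complement of the kernel. So `f` is the coboundary of a 1-cochain `c`, and on
a cycle `x` the value of `φ` is `-c (∂ x) = 0`.
-/

section

open groupHomology Finsupp TensorProduct
open scoped IsMulCommutative

/-! ### Splitting central extensions of metacyclic groups -/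

/-- In a divisible group, an element `d` is an `s`-th power of an element of exponent `m` as soon
as it satisfies the evident necessary condition: `d ^ k = 1` whenever `m ∣ k * s`. -/
theorem exists_pow_eq_one_and_zpow_eq {D : Type*} [Group D]
    (hD : ∀ n : ℕ, n ≠ 0 → ∀ d : D, ∃ y : D, y ^ n = d) {m : ℕ} (hm : m ≠ 0) (s : ℤ) (d : D)
    (hd : ∀ k : ℤ, (m : ℤ) ∣ k * s → d ^ k = 1) : ∃ e : D, e ^ m = 1 ∧ e ^ s = d := by
  have hg : Int.gcd m s ≠ 0 := by
    intro h
    exact hm (by simpa using (Int.gcd_eq_zero_iff.1 h).1)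
  -- A `gcd m s`-th root `y` of `d` has exponent `m`, so that by Bézout a power of `y` works.
  obtain ⟨y, hy⟩ := hD _ hg d
  obtain ⟨k, hk⟩ := Int.gcd_dvd_left (m : ℤ) s
  obtain ⟨l, hl⟩ := Int.gcd_dvd_right (m : ℤ) s
  have hym : y ^ (m : ℤ) = 1 := by
    rw [hk, zpow_mul, zpow_natCast, hy]
    refine hd k ⟨l, ?_⟩
    conv_lhs => rw [hl]
    conv_rhs => rw [hk]
    ring
  have hbez := Int.gcd_eq_gcd_ab (m : ℤ) s
  refine ⟨y ^ Int.gcdB m s, ?_, ?_⟩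
  · rw [← zpow_natCast, zpow_comm, hym, one_zpow]
  · rw [← zpow_mul, ← hy, ← zpow_natCast, hbez, zpow_add, zpow_mul y (m : ℤ), hym, one_zpow,
      one_mul, mul_comm]

/-- Let `K` be a normal cyclic subgroup of `G` with cyclic quotient. A surjection `π : E →* G` splits
if a generator of `K` and a generator of the quotient have lifts `a` and `b` to `E` that satisfy the
defining relations of the metacyclic group `G`: the subgroup `⟨b⟩⟨a⟩` is then a complement of the
kernel. -/
theorem exists_section_of_lifts {E G : Type*} [Group E] [Group G] [Finite G] (π : E →* G)
    {K : Subgroup G} [K.Normal] {a b : E}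
    (ha : Subgroup.zpowers (π a) = K)
    (hb : ∀ x : G ⧸ K, x ∈ Subgroup.zpowers (QuotientGroup.mk (π b)))
    (hao : a ^ orderOf (π a) = 1) {r t : ℤ} (hab : b * a * b⁻¹ = a ^ r)
    (hbo : b ^ orderOf (QuotientGroup.mk (π b) : G ⧸ K) = a ^ t) :
    ∃ σ : G →* E, ∀ g, π (σ g) = g := by
  set A := Subgroup.zpowers a
  have hfin : IsOfFinOrder a :=
    isOfFinOrder_iff_pow_eq_one.2 ⟨_, orderOf_pos _, hao⟩
  have : Finite A := hfin.finite_zpowers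
  -- Conjugation by `b` maps the finite group `A` into itself, hence onto itself.
  have hnorm : Subgroup.zpowers b ≤ Subgroup.normalizer (A : Set E) := by
    rw [Subgroup.zpowers_le]
    have hmap : A.map (MulAut.conj b).toMonoidHom = A := by
      apply Subgroup.eq_of_le_of_card_ge
      · rw [MonoidHom.map_zpowers, Subgroup.zpowers_le]
        exact ⟨r, by simpa using hab.symm⟩
      · exact (Nat.card_congr (A.equivMapOfInjective _ (MulAut.conj b).injective).toEquiv).le
    rw [Subgroup.mem_normalizer_iff]
    intro h
    conv_rhs => rw [← hmap]
    simp [Subgroup.mem_map]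
  set H := Subgroup.zpowers b ⊔ A
  have hmem : ∀ x, x ∈ H ↔ ∃ i j : ℤ, b ^ i * a ^ j = x := by
    intro x
    rw [← SetLike.mem_coe, Subgroup.coe_mul_of_left_le_normalizer_right _ _ hnorm, Set.mem_mul]
    simp [A, Subgroup.mem_zpowers_iff]
  have hinj : ∀ x ∈ H, π x = 1 → x = 1 := by
    intro x hx hx1
    obtain ⟨i, j, rfl⟩ := (hmem x).1 hx
    have hA : ∀ k : ℤ, π (a ^ k) = 1 → a ^ k = 1 := by
      intro k hk
      rw [map_zpow, ← orderOf_dvd_iff_zpow_eq_one] at hk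
      obtain ⟨l, rfl⟩ := hk
      rw [zpow_mul, zpow_natCast, hao, one_zpow]
    have hi : (QuotientGroup.mk (π b) : G ⧸ K) ^ i = 1 := by
      have h1 : (QuotientGroup.mk (π (b ^ i * a ^ j)) : G ⧸ K) = 1 := by rw [hx1]; rfl
      rw [map_mul, map_zpow, QuotientGroup.mk_mul, QuotientGroup.mk_zpow] at h1
      rwa [(QuotientGroup.eq_one_iff (π (a ^ j))).2 (by
        rw [← ha, map_zpow]; exact Subgroup.zpow_mem_zpowers _ _), mul_one] at h1
    rw [← orderOf_dvd_iff_zpow_eq_one] at hi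
    obtain ⟨l, rfl⟩ := hi
    rw [zpow_mul, zpow_natCast, hbo, ← zpow_mul, ← zpow_add] at hx1 ⊢
    exact hA _ hx1
  have hsurj : ∀ g : G, ∃ x ∈ H, π x = g := by
    intro g
    obtain ⟨i, hi⟩ := hb (QuotientGroup.mk g)
    have hk : (π b ^ i)⁻¹ * g ∈ K := by
      rw [← QuotientGroup.eq]
      simpa using hi
    rw [← ha] at hk
    obtain ⟨j, hj⟩ := hk
    refine ⟨b ^ i * a ^ j, (hmem _).2 ⟨i, j, rfl⟩, ?_⟩
    have hj' : π a ^ j = (π b ^ i)⁻¹ * g := hj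
    rw [map_mul, map_zpow, map_zpow, hj', mul_inv_cancel_left]
  choose σ hσH hσ using hsurj
  exact ⟨MonoidHom.mk' σ fun g h => by
    refine eq_of_mul_inv_eq_one
      (hinj _ (H.mul_mem (hσH _) (H.inv_mem (H.mul_mem (hσH g) (hσH h)))) ?_)
    simp [hσ], hσ⟩

/-- A central extension of a finite metacyclic group by a divisible group splits if each lift of the
generator `b` modulo `K` commutes with each lift of an element of `K` that commutes with `b`. -/
theorem exists_section_of_commute {E G : Type*} [Group E] [Group G] [Finite G] (π : E →* G)
    (hπ : Function.Surjective π) (hc : π.ker ≤ Subgroup.center E)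
    (hdiv : ∀ n : ℕ, n ≠ 0 → ∀ d ∈ π.ker, ∃ y ∈ π.ker, y ^ n = d)
    {K : Subgroup G} [K.Normal] {b : G} (hK : IsCyclic K)
    (hb : ∀ x : G ⧸ K, x ∈ Subgroup.zpowers (QuotientGroup.mk b))
    (hcomm : ∀ x y : E, π x = b → π y ∈ K → Commute (π x) (π y) → Commute x y) :
    ∃ σ : G →* E, ∀ g, π (σ g) = g := by
  have hcen : ∀ d ∈ π.ker, ∀ x, Commute d x := fun d hd x =>
    (Subgroup.mem_center_iff.1 (hc hd) x).symm
  obtain ⟨⟨a, haK⟩, ha⟩ := hK.exists_generator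
  have haz : Subgroup.zpowers a = K := by
    refine le_antisymm (Subgroup.zpowers_le.2 haK) fun x hx => ?_
    obtain ⟨i, hi⟩ := ha ⟨x, hx⟩
    exact ⟨i, congrArg Subtype.val hi⟩
  -- Divisibility of the kernel allows `a` to be lifted to an element of the same order.
  obtain ⟨a₁, ha₁, ha₁o⟩ : ∃ a₁, π a₁ = a ∧ a₁ ^ orderOf a = 1 := by
    obtain ⟨a₀, rfl⟩ := hπ a
    obtain ⟨y, hy, hy'⟩ := hdiv (orderOf (π a₀)) (orderOf_pos _).ne' (a₀ ^ orderOf (π a₀))⁻¹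
      (by simp [MonoidHom.mem_ker, pow_orderOf_eq_one])
    refine ⟨y * a₀, by simp [MonoidHom.mem_ker.1 hy], ?_⟩
    rw [(hcen y hy a₀).mul_pow, hy', inv_mul_cancel]
  obtain ⟨b₁, rfl⟩ := hπ b
  obtain ⟨r, hr⟩ : ∃ r : ℤ, a ^ r = π b₁ * a * (π b₁)⁻¹ := by
    have h : π b₁ * a * (π b₁)⁻¹ ∈ Subgroup.zpowers a := by
      rw [haz]
      exact Subgroup.Normal.conj_mem inferInstance _ haK _
    exact h
  -- The conjugation relation lifts up to a central error `d`.
  obtain ⟨d, hd, hbd⟩ : ∃ d ∈ π.ker, b₁ * a₁ * b₁⁻¹ = d * a₁ ^ r :=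
    ⟨b₁ * a₁ * b₁⁻¹ * (a₁ ^ r)⁻¹, by simp [MonoidHom.mem_ker, ha₁, hr], by group⟩
  have hdk : ∀ k : ℤ, ((orderOf a : ℕ) : ℤ) ∣ k * (r - 1) → d ^ k = 1 := by
    rintro k ⟨l, hl⟩
    have hak : a₁ ^ (r * k) = a₁ ^ k := by
      rw [show r * k = orderOf a * l + k by rw [← hl]; ring, zpow_add, zpow_mul, zpow_natCast,
        ha₁o, one_zpow, one_mul]
    have h1 : b₁ * a₁ ^ k * b₁⁻¹ = d ^ k * a₁ ^ k := by
      rw [← conj_zpow, hbd, (hcen d hd _).mul_zpow, ← zpow_mul, hak]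
    have h2 : Commute b₁ (a₁ ^ k) := by
      refine hcomm _ _ rfl (by rw [map_zpow, ha₁]; exact K.zpow_mem haK k) ?_
      have h3 := congrArg π h1
      rw [map_mul, map_mul, map_mul, map_zpow π d, MonoidHom.mem_ker.1 hd, one_zpow, one_mul,
        map_inv, mul_inv_eq_iff_eq_mul] at h3
      exact h3
    rw [h2.eq, mul_inv_cancel_right] at h1
    exact (right_eq_mul.1 h1)
  -- The error is absorbed by replacing `a₁` with `e * a₁`.
  obtain ⟨⟨e, he⟩, hem, hes⟩ := exists_pow_eq_one_and_zpow_eq (D := π.ker) (m := orderOf a)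
    (fun n hn d => by
      obtain ⟨y, hy, hy'⟩ := hdiv n hn d d.2
      exact ⟨⟨y, hy⟩, Subtype.ext hy'⟩)
    (orderOf_pos a).ne' (r - 1) ⟨d, hd⟩ fun k hk => Subtype.ext (hdk k hk)
  replace hem : e ^ orderOf a = 1 := congrArg Subtype.val hem
  replace hes : e ^ (r - 1) = d := congrArg Subtype.val hes
  have hea : π (e * a₁) = a := by rw [map_mul, MonoidHom.mem_ker.1 he, one_mul, ha₁]
  have heo : (e * a₁) ^ orderOf (π (e * a₁)) = 1 := by
    rw [hea, (hcen e he a₁).mul_pow, hem, ha₁o, one_mul]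
  have heb : b₁ * (e * a₁) * b₁⁻¹ = (e * a₁) ^ r := by
    rw [(hcen e he a₁).mul_zpow, ← mul_assoc, ← (hcen e he b₁).eq, mul_assoc, mul_assoc,
      ← mul_assoc b₁, hbd, ← hes, ← mul_assoc, ← zpow_one_add]
    congr 2
    ring
  -- The power relation is lifted likewise, by a central correction of `b₁`.
  have hbt : π b₁ ^ orderOf (QuotientGroup.mk (π b₁) : G ⧸ K) ∈ Subgroup.zpowers a := by
    rw [haz, ← QuotientGroup.eq_one_iff, QuotientGroup.mk_pow, pow_orderOf_eq_one]
  obtain ⟨t, ht⟩ := hbt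
  replace ht : a ^ t = π b₁ ^ orderOf (QuotientGroup.mk (π b₁) : G ⧸ K) := ht
  obtain ⟨y, hy, hyn⟩ := hdiv (orderOf (QuotientGroup.mk (π b₁) : G ⧸ K)) (orderOf_pos _).ne'
    ((e * a₁) ^ t * (b₁ ^ orderOf (QuotientGroup.mk (π b₁) : G ⧸ K))⁻¹)
    (by rw [MonoidHom.mem_ker, map_mul, map_zpow, hea, ht, map_inv, map_pow, mul_inv_cancel])
  have hyb : π (y * b₁) = π b₁ := by rw [map_mul, MonoidHom.mem_ker.1 hy, one_mul]
  refine exists_section_of_lifts π (K := K) (a := e * a₁) (b := y * b₁) (by rw [hea, haz])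
    (by rwa [hyb]) heo (r := r) (t := t) ?_ ?_
  · rw [← heb, (hcen y hy b₁).eq, mul_inv_rev, mul_assoc b₁, (hcen y hy _).eq]
    group
  · rw [hyb, (hcen y hy b₁).mul_pow, hyn, inv_mul_cancel_right]

/-! ### Cocycles and central extensions -/

/-- The underlying set `D × G` of the central extension of `G` by the additive group `D` with
cocycle `f`. The cocycle, which is not assumed to be normalized, is a parameter of the type so that
it determines the multiplication. -/
@[ext]
structure CocycleExtension {G D : Type*} (f : G → G → D) where
  /-- The coordinate in the kernel of the extension. -/
  fiber : D
  /-- The image in `G`. -/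
  base : G

namespace CocycleExtension

variable {G D : Type*} [Group G] [AddCommGroup D] {f : G → G → D}

/-- The group structure `(d, g) (e, h) = (d + e + f g h, g h)` on the central extension defined by a
2-cocycle `f`. Its unit is `(-f 1 1, 1)`. -/
abbrev group (hf : ∀ g h j, f h j + f g (h * j) = f (g * h) j + f g h) :
    Group (CocycleExtension f) :=
  letI : Mul (CocycleExtension f) :=
    ⟨fun x y => ⟨x.fiber + y.fiber + f x.base y.base, x.base * y.base⟩⟩
  letI : One (CocycleExtension f) := ⟨⟨-f 1 1, 1⟩⟩
  letI : Inv (CocycleExtension f) :=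
    ⟨fun x => ⟨-x.fiber - f x.base⁻¹ x.base - f 1 1, x.base⁻¹⟩⟩
  Group.ofLeftAxioms
    (fun x y z => CocycleExtension.ext
      (by
        change x.fiber + y.fiber + f x.base y.base + z.fiber + f (x.base * y.base) z.base =
          x.fiber + (y.fiber + z.fiber + f y.base z.base) + f x.base (y.base * z.base)
        calc _ = x.fiber + y.fiber + z.fiber +
              (f (x.base * y.base) z.base + f x.base y.base) := by abel
          _ = _ := by rw [← hf]; abel) (mul_assoc _ _ _))
    (fun x => CocycleExtension.ext
      (by
        change -f 1 1 + x.fiber + f 1 x.base = x.fiber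
        have h := hf 1 1 x.base
        simp only [one_mul, add_right_inj] at h
        rw [h]
        abel) (one_mul _))
    (fun x => CocycleExtension.ext
      (by
        change -x.fiber - f x.base⁻¹ x.base - f 1 1 + x.fiber + f x.base⁻¹ x.base = -f 1 1
        abel) (inv_mul_cancel _))

end CocycleExtension

/-- On a finite metacyclic group, a 2-cocycle `f` with values in a divisible group is a coboundary if
`f b z = f z b` for all `z ∈ K` that commute with the generator `b` modulo `K`. -/
theorem exists_eq_coboundary {G D : Type*} [Group G] [Finite G] [AddCommGroup D]
    (hD : ∀ n : ℕ, n ≠ 0 → ∀ d : D, ∃ y : D, n • y = d) {f : G → G → D}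
    (hf : ∀ g h j, f h j + f g (h * j) = f (g * h) j + f g h)
    {K : Subgroup G} [K.Normal] {b : G} (hK : IsCyclic K)
    (hb : ∀ x : G ⧸ K, x ∈ Subgroup.zpowers (QuotientGroup.mk b))
    (hfb : ∀ z ∈ K, Commute b z → f b z = f z b) :
    ∃ c : G → D, ∀ g h, f g h = c (g * h) - c g - c h := by
  let := CocycleExtension.group hf
  have hmul : ∀ x y : CocycleExtension f,
    x * y = ⟨x.fiber + y.fiber + f x.base y.base, x.base * y.base⟩ := fun _ _ => rfl
  have hone : (1 : CocycleExtension f) = ⟨-f 1 1, 1⟩ := rfl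
  let π : CocycleExtension f →* G :=
    { toFun := CocycleExtension.base, map_one' := rfl, map_mul' := fun _ _ => rfl }
  have h1 : ∀ g, f 1 g = f 1 1 := fun g => by
    have h := hf 1 1 g
    simp only [one_mul, add_right_inj] at h
    exact h
  have h2 : ∀ g, f g 1 = f 1 1 := fun g => by
    have h := hf g 1 1
    simp only [mul_one, add_left_inj] at h
    exact h.symm
  have hker : ∀ x ∈ π.ker, x = ⟨x.fiber, 1⟩ := fun x hx => CocycleExtension.ext rfl hx
  -- The kernel is isomorphic to `D` by `d ↦ (d - f 1 1, 1)`.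
  have hpow : ∀ (n : ℕ) (d : D),
      (⟨d - f 1 1, 1⟩ : CocycleExtension f) ^ n = ⟨n • d - f 1 1, 1⟩ := by
    intro n d
    induction n with
    | zero => simp [hone]
    | succ n ih =>
      rw [pow_succ, ih, hmul, succ_nsmul]
      refine CocycleExtension.ext ?_ (one_mul 1)
      change n • d - f 1 1 + (d - f 1 1) + f 1 1 = _
      rw [add_assoc, sub_add_cancel, sub_add_eq_add_sub]
  obtain ⟨σ, hσ⟩ := exists_section_of_commute π (fun g => ⟨⟨0, g⟩, rfl⟩)
    (fun x hx => Subgroup.mem_center_iff.2 fun y => by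
      rw [hker x hx, hmul, hmul]
      simp [h1, h2, add_comm])
    (fun n hn d hd => by
      obtain ⟨y, hy⟩ := hD n hn (d.fiber + f 1 1)
      refine ⟨⟨y - f 1 1, 1⟩, rfl, ?_⟩
      rw [hpow, hy, hker d hd, add_sub_cancel_right])
    hK hb
    (fun x y hx hy hxy => by
      have hx' : x.base = b := hx
      have h := hfb y.base hy (hx' ▸ hxy)
      refine CocycleExtension.ext ?_ hxy
      change x.fiber + y.fiber + f x.base y.base = y.fiber + x.fiber + f y.base x.base
      rw [hx', h, add_comm x.fiber])
  refine ⟨fun g => (σ g).fiber, fun g h => ?_⟩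
  have h3 : (σ (g * h)).fiber = (σ g).fiber + (σ h).fiber + f (σ g).base (σ h).base := by
    rw [map_mul, hmul]
  have h4 : ∀ g, (σ g).base = g := hσ
  change f g h = (σ (g * h)).fiber - (σ g).fiber - (σ h).fiber
  rw [h3, h4, h4]
  abel

/-! ### Ganea's homomorphism and characters of the second homology group -/

theorem integralHomologyMap_commutingClass {G H : Type u} [Group G] [Group H] (f : G →* H)
    (x y : G) (h : Commute x y) :
    integralHomologyMap f 2 (commutingClass x y h) = commutingClass (f x) (f y) (h.map f) := by
  refine (H2π_comp_map_apply f (trivialIntRes f) (commutingCycle x y h)).trans ?_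
  refine congrArg (H2π (trivialInt H)) (Subtype.ext ?_)
  refine (coe_mapCycles₂ f (trivialIntRes f) _).trans ?_
  change mapRange.linearMap LinearMap.id
    (mapDomain (Prod.map f f) (single (x, y) 1 - single (y, x) 1)) = _
  rw [sub_eq_add_neg, mapDomain_add, ← single_neg, mapDomain_single, mapDomain_single]
  simp [commutingCycle, sub_eq_add_neg]

/-- Ganea's homomorphism on generators: `g G' ⊗ z` goes to the class of `[g|z] - [z|g]`. -/
theorem ganeaHom_tmul {G : Type u} [Group G] (g : G) (z : Subgroup.center G) :
    ganeaHom G ((h1EquivAbelianization G).symm (Additive.ofMul (Abelianization.of g)) ⊗ₜ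
      Additive.ofMul z) = commutingClass g z (Subgroup.mem_center_iff.1 z.2 g) := by
  -- Both isomorphisms with `H₁` in the definition are composed here with their inverses.
  have h : ganeaHom G ((h1EquivAbelianization G).symm (Additive.ofMul (Abelianization.of g)) ⊗ₜ
      Additive.ofMul z) = integralHomologyMap (mulCenter G) 2
        (abelianizationCross G (Subgroup.center G)
          (h1EquivAbelianization G ((h1EquivAbelianization G).symm
            (Additive.ofMul (Abelianization.of g))))
          (h1EquivAbelianization _ ((h1EquivAbelianization _).symm
            (Additive.ofMul (Abelianization.of z))))) := rfl
  rw [h, AddEquiv.apply_symm_apply, AddEquiv.apply_symm_apply]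
  refine (integralHomologyMap_commutingClass (mulCenter G) (g, 1) (1, z)
    (commute_inl_inr g z)).trans ?_
  congr 1
  · exact mul_one g
  · exact one_mul (z : G)

/-- A homomorphism from `H₂(G)` to a divisible group vanishes if it kills the classes of
`[b|z] - [z|b]`, where `b` generates `G` modulo `K` and `z ∈ K` commutes with `b`. -/
theorem character_eq_zero_of_commutingClass {G : Type u} [Group G] [Finite G]
    {K : Subgroup G} [K.Normal] {b : G} (hK : IsCyclic K)
    (hb : ∀ x : G ⧸ K, x ∈ Subgroup.zpowers (QuotientGroup.mk b))
    {D : Type*} [AddCommGroup D] [DivisibleBy D ℤ] (φ : IntegralHomology G 2 →+ D)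
    (hφ : ∀ z ∈ K, ∀ h : Commute b z, φ (commutingClass b z h) = 0) : φ = 0 := by
  -- By injectivity of `D`, the homomorphism induced on cycles extends to all 2-chains; the
  -- extension vanishes on boundaries, which makes it a 2-cocycle.
  obtain ⟨ψ, hψ⟩ := (Module.Baer.of_divisible D).extension_property_addMonoidHom
    (cycles₂ (trivialInt G)).subtype.toAddMonoidHom Subtype.val_injective
    (φ.comp (H2π (trivialInt G)).hom.toAddMonoidHom)
  replace hψ : ∀ x : cycles₂ (trivialInt G), ψ x.1 = φ (H2π (trivialInt G) x) :=
    fun x => DFunLike.congr_fun hψ x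
  obtain ⟨c, hc⟩ := exists_eq_coboundary (D := D)
    (fun n hn d => ⟨DivisibleBy.div d (n : ℤ), by
      rw [← natCast_zsmul]; exact DivisibleBy.div_cancel d (by exact_mod_cast hn)⟩)
    (f := fun g h => ψ (single (g, h) 1))
    (fun g h j => by
      have h0 : ψ (d₃₂ (trivialInt G) (single (g, h, j) 1)) = 0 := by
        refine (hψ ⟨_, d₃₂_apply_mem_cycles₂ _⟩).trans ?_
        rw [(H2π_eq_zero_iff _).2 ⟨single (g, h, j) 1, rfl⟩, map_zero]
      rw [d₃₂_single (A := trivialInt G)] at h0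
      replace h0 : ψ (single (h, j) 1 - single (g * h, j) 1 + single (g, h * j) 1 -
        single (g, h) 1) = 0 := h0
      rw [map_sub, map_add, map_sub] at h0
      rw [← sub_eq_zero, ← h0]
      abel)
    hK hb
    (fun z hz h => by
      have h0 : ψ (single (b, z) 1 - single (z, b) 1) = 0 :=
        (hψ (commutingCycle b z h)).trans (hφ z hz h)
      rwa [map_sub, sub_eq_zero] at h0)
  -- The 1-cochain `c`, as a homomorphism on 1-chains.
  let C : (G →₀ ULift.{u} ℤ) →+ D := Finsupp.liftAddHom fun g =>
    ((zmultiplesHom D) (c g)).comp AddEquiv.ulift.toAddMonoidHom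
  have hC : ψ = -C.comp (d₂₁ (trivialInt G)).hom.toAddMonoidHom := by
    refine Finsupp.addHom_ext fun ⟨g, h⟩ n => ?_
    have hn : (single (g, h) n : G × G →₀ ULift.{u} ℤ) = n.down • single (g, h) 1 := by
      rw [smul_single]
      congr 1
      apply ULift.ext
      simp
    rw [hn, map_zsmul, map_zsmul]
    congr 1
    refine (hc g h).trans ?_
    change _ = - C (d₂₁ (trivialInt G) (single (g, h) 1))
    rw [d₂₁_single (A := trivialInt G)]
    change _ = - C (single h 1 - single (g * h) 1 + single g 1)
    have hCs : ∀ g, C (single g 1) = c g := fun g => by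
      refine (Finsupp.liftAddHom_apply_single _ g 1).trans ?_
      exact one_zsmul (c g)
    rw [map_add, map_sub, hCs, hCs, hCs]
    abel
  ext x
  induction x using H2_induction_on with
  | h x =>
    rw [← hψ, hC]
    change - C (d₂₁ (trivialInt G) x.1) = 0
    rw [show d₂₁ (trivialInt G) x.1 = 0 from x.2, map_zero, neg_zero]

end

theorem mainTheorem4 {G : Type*} [Group G] [Finite G] (hG : IsMetacyclic G) :
    Function.Surjective (ganeaHom G) := by
  obtain ⟨K, _, hK, hQ⟩ := hG
  obtain ⟨q, hq⟩ := hQ.exists_generator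
  obtain ⟨b, rfl⟩ := QuotientGroup.mk_surjective q
  have hcenter : ∀ z ∈ K, Commute b z → z ∈ Subgroup.center G := by
    intro z hz hbz
    refine Subgroup.mem_center_iff.2 fun g => ?_
    obtain ⟨i, hi⟩ := hq g
    obtain ⟨k, rfl⟩ : ∃ k : K, g = b ^ i * k :=
      ⟨⟨(b ^ i)⁻¹ * g, QuotientGroup.eq.1 hi⟩, by simp⟩
    have hkz : Commute (k : G) z := by
      let := hK.commGroup
      exact congrArg Subtype.val (mul_comm k ⟨z, hz⟩)
    exact (hbz.zpow_left i).mul_left hkz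
  -- The cokernel vanishes because all its characters do.
  intro x
  refine (QuotientAddGroup.eq_zero_iff (N := (ganeaHom G).range) x).1 ?_
  refine CharacterModule.eq_zero_of_character_apply fun χ => ?_
  refine DFunLike.congr_fun (character_eq_zero_of_commutingClass hK hq
    (χ.comp (QuotientAddGroup.mk' (ganeaHom G).range)) fun z hz h => ?_) x
  have hmem : commutingClass b z h ∈ (ganeaHom G).range :=
    ⟨_, ganeaHom_tmul b ⟨z, hcenter z hz h⟩⟩
  exact (congrArg χ ((QuotientAddGroup.eq_zero_iff _).2 hmem)).trans (map_zero χ)
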